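/- **Setting.** The squared channel gain $h\ge 0$ has a probability density $p$ with $\mathbf E_h[\log(1+h)]<\infty$, where $\mathbf E_h[f]=\int f(h)p(h)\,dh$. The noise power $\sigma_N^2>0$, the rate $R>0$ and the power budgets $\mathcal P,\mathcal J\ge 0$ are given. For measurable power allocations $P,J\ge 0$ over one frame, let $$C(P,J)=\mathbf E_h\Big[\log\Big(1+\frac{hP(h)}{\sigma_N^2+J(h)}\Big)\Big],\qquad \pi(J)=\inf\{\mathbf E_h[P]: P\ge 0,\ C(P,J)\ge R\},$$ $$\mathscr P_M(j)=\sup\{\pi(J): J\ge 0,\ \mathbf E_h[J]\le j\}\qquad (j\ge 0).$$ The many frames are indexed by $\omega\in[0,1]$; the fraction of frames in a set is its Lebesgue measure. A pure strategy of the jammer (transmitter) is a jointly measurable function $J_\omega(h)\ge 0$ ($P_\omega(h)\ge0$) with average power $\int_0^1\mathbf E_h[J_\omega]\,d\omega\le\mathcal J$ (respectively $\int_0^1\mathbf E_h[P_\omega]\,d\omega\le\mathcal P$). The outage probability $P_{out}(P,J)$ is the measure of $\{\omega: C(P_\omega,J_\omega)<R\}$. In the maximin scenario the jammer plays first: it maximizes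 $V(J)=\inf_P P_{out}(P,J)$, and the transmitter answers $J$ by minimizing $P_{out}(\cdot,J)$. **Theorem.** The number $\mathscr P_M(\mathcal J)$ is positive and finite, and the supremum and the infimum that define it are attained, with $\mathbf E_h[J]=\mathcal J$. Put $p_t=\min\{1,\mathcal P/\mathscr P_M(\mathcal J)\}$. 1. It is optimal for the jammer to allocate the same power $J_M=\mathcal J$ to every frame: jammer strategies $J$ with $\mathbf E_h[J_\omega]=\mathcal J$ and $\pi(J_\omega)=\mathscr P_M(\mathcal J)$ for every $\omega$ exist, and each of them satisfies $V(J)\ge V(J')$ for all jammer strategies $J'$, with $V(J)=1-p_t$. 2. Against such a $J$ the transmitter transmits on a fraction $p_t$ of the frames. Measurable sets $S$ of frames of measure $p_t$ exist. For each such set there is a jointly measurable $P\ge 0$ such that $\mathbf E_h[P_\omega]=\mathscr P_M(\mathcal J)$ and $C(P_\omega,J_\omega)\ge R$ for $\omega\in S$, and $P_\omega=0$ for $\omega\notin S$; every such $P$ is an optimal reply of the transmitter. Conversely, every optimal reply $P$ has outage probability $1-p_t$, and $\{\omega:\mathbf E_h[P_\omega]>0\}$ has measure $p_t$. -/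

import Mathlib

open MeasureTheory
open scoped NNReal ENNReal

noncomputable section

namespace Jamming

/-- `p` is a probability density function of the squared channel gain, which is non-negative. -/
structure IsGainPDF (p : ℝ → ℝ) : Prop where
  measurable : Measurable p
  nonneg : ∀ h, 0 ≤ p h
  eq_zero_of_neg : ∀ h, h < 0 → p h = 0
  lintegral_eq_one : ∫⁻ h, ENNReal.ofReal (p h) = 1

/-- The distribution of the squared channel gain: `A ↦ ∫_A p(h) dh`. -/
def gainMeasure (p : ℝ → ℝ) : Measure ℝ :=
  volume.withDensity fun h => ENNReal.ofReal (p h)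

/-- The power `E_h[P(h)]` that the allocation `P` spends over one frame. -/
def framePower (p : ℝ → ℝ) (P : ℝ → ℝ≥0) : ℝ≥0∞ :=
  ∫⁻ h, (P h : ℝ≥0∞) ∂(gainMeasure p)

/-- The ergodic capacity `C(P, J) = E_h[log (1 + h P(h) / (N + J(h)))]` of one frame,
with noise power `N`. It is the expectation of a non-negative quantity, with values in `[0, ∞]`. -/
def capacity (p : ℝ → ℝ) (N : ℝ) (P J : ℝ → ℝ≥0) : ℝ≥0∞ :=
  ∫⁻ h, ENNReal.ofReal (Real.log (1 + h * (P h : ℝ) / (N + (J h : ℝ)))) ∂(gainMeasure p)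

/-- The least power (inner minimum) with which the transmitter obtains capacity at least `R`
over a frame that is jammed by `J`. -/
def minPower (p : ℝ → ℝ) (N R : ℝ) (J : ℝ → ℝ≥0) : ℝ≥0∞ :=
  ⨅ (P : ℝ → ℝ≥0) (_ : Measurable P) (_ : ENNReal.ofReal R ≤ capacity p N P J), framePower p P

/-- The required transmitter power over a frame in which the jammer invests the power `j`:
the largest `minPower` that the jammer can enforce with power at most `j`. -/
def requiredPower (p : ℝ → ℝ) (N R : ℝ) (j : ℝ≥0) : ℝ≥0∞ :=
  ⨆ (J : ℝ → ℝ≥0) (_ : Measurable J) (_ : framePower p J ≤ j), minPower p N R J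

/-- A pure strategy of either player. The frames are indexed by the unit interval, the Lebesgue
measure of a set of frames being the fraction of frames in it; `s ω h` is the power used in the
frame `ω` at channel gain `h`. -/
abbrev Strategy := unitInterval → ℝ → ℝ≥0

/-- The strategy obeys the average power constraint with bound `B`, the average being taken over
all frames. -/
def Admissible (p : ℝ → ℝ) (B : ℝ≥0) (s : Strategy) : Prop :=
  Measurable (Function.uncurry s) ∧ ∫⁻ ω, framePower p (s ω) ≤ B

/-- The outage probability: the fraction of frames whose capacity is below the rate `R`. -/
def outage (p : ℝ → ℝ) (N R : ℝ) (P J : Strategy) : ℝ≥0∞ :=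
  volume {ω | capacity p N (P ω) (J ω) < ENNReal.ofReal R}

/-- `P` is optimal for the transmitter, who knows the strategy `J` of the jammer. -/
def IsBestResponse (p : ℝ → ℝ) (N R : ℝ) (Pbar : ℝ≥0) (J P : Strategy) : Prop :=
  Admissible p Pbar P ∧ ∀ P', Admissible p Pbar P' → outage p N R P J ≤ outage p N R P' J

/-- The outage probability that the jammer secures by playing `J` first. -/
def securedOutage (p : ℝ → ℝ) (N R : ℝ) (Pbar : ℝ≥0) (J : Strategy) : ℝ≥0∞ :=
  ⨅ (P : Strategy) (_ : Admissible p Pbar P), outage p N R P J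

/-- `J` is optimal for the jammer in the maximin scenario. -/
def IsMaximinOptimal (p : ℝ → ℝ) (N R : ℝ) (Pbar Jbar : ℝ≥0) (J : Strategy) : Prop :=
  Admissible p Jbar J ∧
    ∀ J', Admissible p Jbar J' → securedOutage p N R Pbar J' ≤ securedOutage p N R Pbar J

/-- The jammer invests the same power `j` in every frame, and distributes it within each frame so
that the power required from the transmitter is as large as possible. -/
def IsUniformJamming (p : ℝ → ℝ) (N R : ℝ) (j : ℝ≥0) (J : Strategy) : Prop :=
  Measurable (Function.uncurry J) ∧
    ∀ ω, framePower p (J ω) = j ∧ minPower p N R (J ω) = requiredPower p N R j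

/-- On the frames of `S`, and only there, the transmitter is active: it spends the power `a` and
achieves the rate `R`. -/
def IsOnOff (p : ℝ → ℝ) (N R : ℝ) (a : ℝ≥0∞) (S : Set unitInterval) (J P : Strategy) : Prop :=
  Measurable (Function.uncurry P) ∧
    (∀ ω ∈ S, framePower p (P ω) = a ∧ ENNReal.ofReal R ≤ capacity p N (P ω) (J ω)) ∧
    ∀ ω ∉ S, P ω = 0

/-- The fraction `min {1, Pbar / requiredPower j}` of frames. -/
def onFraction (p : ℝ → ℝ) (N R : ℝ) (Pbar j : ℝ≥0) : ℝ≥0∞ :=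
  min 1 ((Pbar : ℝ≥0∞) / requiredPower p N R j)

end Jamming

end

/-!
Within one frame the game has a saddle point, and it can be extended to all frames by means of a
reply that depends on the jamming in the simplest way.

Given multipliers `a, ν > 0`, let `snr a ν h = min ν (a - 1 / h)⁺` and
`jam a ν h = (a * h / (1 + ν * h) - 1)⁺`. If the jammer plays `J = N * jam a ν`, then the
allocation `P = snr a ν * (N + J)` is the water-filling against `J` at the level `a * N`
(`mul_le_fill`, `fill_eq`), so no allocation reaches its capacity with less power
(`framePower_le_of_fill`). Moreover `snr a ν ≤ ν`, with equality wherever the jammer is active. By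
the intermediate value theorem, applied first to `a` and then to `ν`, the multipliers can be chosen
such that `J` has the power `j` and `P` has the capacity `R` (`exists_multipliers`); this is the
saddle point (`exists_isSaddlePoint`).

Write `y` for `snr a ν`. Against an arbitrary jamming `J'`, the reply `y * (N + J')` has the same
ratio `y` of signal to noise, hence the capacity `R`. Its power `E[y * N] + E[y * J']` is at most
`E[y * N] + ν * E[J']`, with equality for `J' = J`. Hence the required power at `j` is
`E[y * N] + ν * j`, and `J` attains it. The bound is affine in `E[J']` and the reply is jointly
measurable in the frame and the gain, so if the average power of the jammer over all frames is at
most `j`, the transmitter can reach the rate in all frames with at most the required power on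
average. Averaging over the arcs of a circle, some set of frames of measure `onFraction` carries
at most this fraction of the power (`exists_volume_eq_setLIntegral_le`), which bounds the outage
that any jammer can secure (`IsSaddlePoint.securedOutage_le`). Conversely, against uniform jamming
every frame without outage costs at least the required power
(`IsUniformJamming.volume_le_onFraction`), and if the fraction of such frames is maximal and less
than one, they use up the whole budget (`IsUniformJamming.volume_framePower_pos`).
-/

namespace Jamming

/-! ### Cheap sets of frames of given measure -/

/-- The arc of length `t` that starts at `s`, on the circle obtained by gluing the end points of
the unit interval. -/
def arc (t : ℝ) (s : unitInterval) : Set unitInterval :=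
  {ω | ((s : ℝ) ≤ ω ∧ (ω : ℝ) < s + t) ∨ (ω : ℝ) + 1 < s + t}

theorem measurableSet_arc_graph (t : ℝ) :
    MeasurableSet {x : unitInterval × unitInterval | x.2 ∈ arc t x.1} := by
  have h1 : Measurable fun x : unitInterval × unitInterval => (x.1 : ℝ) :=
    measurable_subtype_coe.comp measurable_fst
  have h2 : Measurable fun x : unitInterval × unitInterval => (x.2 : ℝ) :=
    measurable_subtype_coe.comp measurable_snd
  exact ((measurableSet_le h1 h2).inter (measurableSet_lt h2 (h1.add_const t))).union
    (measurableSet_lt (h2.add_const 1) (h1.add_const t))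

theorem measurableSet_arc (t : ℝ) (s : unitInterval) : MeasurableSet (arc t s) :=
  measurable_prodMk_left (measurableSet_arc_graph t)

theorem volume_arc {t : ℝ} (ht : t ∈ unitInterval) (s : unitInterval) :
    volume (arc t s) = ENNReal.ofReal t := by
  have ht0 := ht.1
  have ht1 := ht.2
  have hs0 := s.2.1
  have hs1 := s.2.2
  rcases le_or_gt ((s : ℝ) + t) 1 with h | h
  · have : arc t s = Set.Ico s ⟨s + t, by constructor <;> linarith⟩ := by
      ext ω
      have := ω.2.1
      simp only [arc, Set.mem_ofPred_eq, Set.mem_Ico, ← Subtype.coe_le_coe, ← Subtype.coe_lt_coe]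
      grind
    rw [this, unitInterval.volume_Ico]
    congr 1
    simp
  · have : arc t s = Set.Ici s ∪ Set.Iio ⟨s + t - 1, by constructor <;> linarith⟩ := by
      ext ω
      have := ω.2.2
      simp only [arc, Set.mem_ofPred_eq, Set.mem_union, Set.mem_Ici, Set.mem_Iio,
        ← Subtype.coe_le_coe, ← Subtype.coe_lt_coe]
      grind
    rw [this, measure_union _ measurableSet_Iio, unitInterval.volume_Ici, unitInterval.volume_Iio,
      ← ENNReal.ofReal_add (by linarith) (by simp; linarith)]
    · congr 1
      simp
    · rw [Set.disjoint_left]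
      intro ω h1 h2
      simp only [Set.mem_Ici, Set.mem_Iio, ← Subtype.coe_le_coe, ← Subtype.coe_lt_coe] at h1 h2
      linarith

theorem volume_setOf_mem_arc {t : ℝ} (ht : t ∈ unitInterval) (ω : unitInterval) :
    volume {s | ω ∈ arc t s} = ENNReal.ofReal t := by
  have ht0 := ht.1
  have ht1 := ht.2
  have hω0 := ω.2.1
  have hω1 := ω.2.2
  rcases le_or_gt t ω with h | h
  · have : {s | ω ∈ arc t s} = Set.Ioc ⟨ω - t, by constructor <;> linarith⟩ ω := by
      ext s
      have := s.2.2
      simp only [arc, Set.mem_ofPred_eq, Set.mem_Ioc, ← Subtype.coe_le_coe, ← Subtype.coe_lt_coe]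
      grind
    rw [this, unitInterval.volume_Ioc]
    congr 1
    simp
  · have : {s | ω ∈ arc t s} = Set.Iic ω ∪ Set.Ioi ⟨ω + 1 - t, by constructor <;> linarith⟩ := by
      ext s
      have := s.2.1
      simp only [arc, Set.mem_ofPred_eq, Set.mem_union, Set.mem_Iic, Set.mem_Ioi,
        ← Subtype.coe_le_coe, ← Subtype.coe_lt_coe]
      grind
    rw [this, measure_union _ measurableSet_Ioi, unitInterval.volume_Iic, unitInterval.volume_Ioi,
      ← ENNReal.ofReal_add (by linarith) (by simp; linarith)]
    · congr 1
      simp only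
      ring
    · rw [Set.disjoint_left]
      intro s h1 h2
      simp only [Set.mem_Iic, Set.mem_Ioi, ← Subtype.coe_le_coe, ← Subtype.coe_lt_coe] at h1 h2
      linarith

/-- Some set of measure `t` carries at most the fraction `t` of the integral of `f`: averaged over
all arcs of length `t`, the integral of `f` over the arc is `t * ∫⁻ ω, f ω`. -/
theorem exists_volume_eq_setLIntegral_le {f : unitInterval → ℝ≥0∞} (hf : Measurable f) {t : ℝ≥0∞}
    (ht : t ≤ 1) :
    ∃ S : Set unitInterval, MeasurableSet S ∧ volume S = t ∧ ∫⁻ ω in S, f ω ≤ t * ∫⁻ ω, f ω := by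
  have ht' : t.toReal ∈ unitInterval :=
    ⟨ENNReal.toReal_nonneg, ENNReal.toReal_le_of_le_ofReal zero_le_one (by simpa using ht)⟩
  have htop : t ≠ ⊤ := ne_top_of_le_ne_top ENNReal.one_ne_top ht
  have hk : Measurable fun x : unitInterval × unitInterval =>
      {x : unitInterval × unitInterval | x.2 ∈ arc t.toReal x.1}.indicator (fun x => f x.2) x :=
    (hf.comp measurable_snd).indicator (measurableSet_arc_graph _)
  have h1 (s : unitInterval) : ∫⁻ ω in arc t.toReal s, f ω = ∫⁻ ω,
      {x : unitInterval × unitInterval | x.2 ∈ arc t.toReal x.1}.indicator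
        (fun x => f x.2) (s, ω) :=
    (lintegral_indicator (measurableSet_arc _ _) _).symm
  have h2 : ∫⁻ s, ∫⁻ ω in arc t.toReal s, f ω = t * ∫⁻ ω, f ω := by
    simp_rw [h1]
    rw [lintegral_lintegral_swap hk.aemeasurable, ← lintegral_const_mul _ hf]
    refine lintegral_congr fun ω => ?_
    have hS : MeasurableSet {s | ω ∈ arc t.toReal s} :=
      measurable_prodMk_right (measurableSet_arc_graph t.toReal)
    have : (fun s => {x : unitInterval × unitInterval | x.2 ∈ arc t.toReal x.1}.indicator
        (fun x => f x.2) (s, ω)) = {s | ω ∈ arc t.toReal s}.indicator fun _ => f ω := rfl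
    rw [this, lintegral_indicator_const hS, volume_setOf_mem_arc ht', ENNReal.ofReal_toReal htop,
      mul_comm]
  have h3 : Measurable fun s => ∫⁻ ω in arc t.toReal s, f ω := by
    simp_rw [h1]
    exact hk.lintegral_prod_right'
  obtain ⟨s, hs⟩ := exists_le_lintegral (μ := (volume : Measure unitInterval)) h3.aemeasurable
  exact ⟨arc t.toReal s, measurableSet_arc _ _, by rw [volume_arc ht', ENNReal.ofReal_toReal htop],
    hs.trans h2.le⟩

/-! ### Multipliers of the saddle point -/

open Filter Topology

/-- The ratio of the transmitted power to the total noise `N + J h` at the saddle point, with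
multipliers `a` and `ν`, for a gain `h > 0`. The gain is not included in this ratio. -/
noncomputable def snr (a ν h : ℝ) : ℝ := min ν (max (a - 1 / h) 0)

/-- The jamming power at the saddle point with multipliers `a` and `ν`, for a gain `h > 0`, in
units of the noise power. -/
noncomputable def jam (a ν h : ℝ) : ℝ := max (a * h / (1 + ν * h) - 1) 0

theorem measurable_snr (a ν : ℝ) : Measurable (snr a ν) := by unfold snr; fun_prop

theorem measurable_jam (a ν : ℝ) : Measurable (jam a ν) := by unfold jam; fun_prop

theorem snr_nonneg {a ν : ℝ} (hν : 0 ≤ ν) (h : ℝ) : 0 ≤ snr a ν h := le_min hν (le_max_right _ _)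

theorem snr_le (a ν h : ℝ) : snr a ν h ≤ ν := min_le_left _ _

theorem jam_nonneg (a ν h : ℝ) : 0 ≤ jam a ν h := le_max_right _ _

theorem jam_self {ν h : ℝ} (hν : 0 ≤ ν) (hh : 0 < h) : jam ν ν h = 0 := by
  have : 0 ≤ ν * h := by positivity
  rw [jam, max_eq_right]
  rw [sub_nonpos, div_le_one (by positivity)]
  linarith

theorem jam_le {a ν h : ℝ} (ha : 0 ≤ a) (hν : 0 < ν) (hh : 0 < h) : jam a ν h ≤ a / ν := by
  refine max_le ?_ (by positivity)
  have : a * h / (1 + ν * h) ≤ a / ν := by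
    rw [div_le_div_iff₀ (by positivity) hν]
    nlinarith
  linarith

/-- Wherever the jammer is active, the ratio `snr a ν h` takes its maximal value `ν`. -/
theorem snr_eq_of_jam_ne_zero {a ν h : ℝ} (hν : 0 < ν) (hh : 0 < h) (hj : jam a ν h ≠ 0) :
    snr a ν h = ν := by
  have h1 : 0 < a * h / (1 + ν * h) - 1 := by
    by_contra hc
    exact hj (max_eq_right (not_lt.1 hc))
  rw [sub_pos, one_lt_div (by positivity)] at h1
  refine min_eq_left (le_max_of_le_left ?_)
  have : ν + 1 / h < a := by
    rw [← mul_lt_mul_iff_left₀ hh, add_mul, one_div, inv_mul_cancel₀ hh.ne']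
    linarith
  linarith

/-- The transmitter fills up the noise `1 + jam a ν h` to the level `a * h`. -/
theorem mul_le_fill {a ν h : ℝ} (hν : 0 < ν) (hh : 0 < h) :
    a * h ≤ (1 + jam a ν h) * (1 + h * snr a ν h) := by
  by_cases hj : jam a ν h = 0
  · have h1 : a * h ≤ 1 + ν * h := by
      have := max_eq_right_iff.1 hj
      rw [sub_nonpos, div_le_one (by positivity)] at this
      exact this
    rw [hj, add_zero, one_mul, snr, min_eq_right]
    · have := mul_le_mul_of_nonneg_left (le_max_left (a - 1 / h) 0) hh.le
      rw [mul_sub, mul_one_div_cancel hh.ne'] at this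
      linarith
    · refine max_le ?_ hν.le
      rw [← mul_le_mul_iff_left₀ hh, sub_mul, one_div, inv_mul_cancel₀ hh.ne']
      linarith
  · rw [snr_eq_of_jam_ne_zero hν hh hj]
    have h1 := le_max_left (a * h / (1 + ν * h) - 1) 0
    change _ ≤ jam a ν h at h1
    rw [sub_le_iff_le_add, div_le_iff₀ (by positivity)] at h1
    linarith

theorem fill_eq {a ν h : ℝ} (hν : 0 < ν) (hh : 0 < h) (hs : 0 < snr a ν h) :
    (1 + jam a ν h) * (1 + h * snr a ν h) = a * h := by
  refine le_antisymm ?_ (mul_le_fill hν hh)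
  have h1 : h * snr a ν h ≤ a * h - 1 := by
    have h2 : snr a ν h ≤ a - 1 / h := by
      rcases max_cases (a - 1 / h) 0 with h3 | h3
      · exact (min_le_right _ _).trans h3.1.le
      · exact absurd hs (not_lt.2 ((min_le_right _ _).trans h3.1.le))
    have := mul_le_mul_of_nonneg_left h2 hh.le
    rw [mul_sub, mul_one_div_cancel hh.ne'] at this
    linarith
  by_cases hj : jam a ν h = 0
  · rw [hj]
    linarith
  · have h2 : jam a ν h = a * h / (1 + ν * h) - 1 := by
      rw [jam] at hj ⊢
      rcases max_cases (a * h / (1 + ν * h) - 1) 0 with h3 | h3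
      · exact h3.1
      · exact absurd h3.1 hj
    rw [h2, snr_eq_of_jam_ne_zero hν hh hj]
    have : 1 + ν * h ≠ 0 := by positivity
    field_simp
    linarith

theorem snr_mono_left {a b : ℝ} (hab : a ≤ b) (ν h : ℝ) : snr a ν h ≤ snr b ν h := by
  unfold snr; gcongr

theorem jam_mono_left {a b ν h : ℝ} (hν : 0 ≤ ν) (hh : 0 < h) (hab : a ≤ b) :
    jam a ν h ≤ jam b ν h := by
  unfold jam; gcongr

/-- Raising the level raises the jamming power in proportion at least. -/
theorem mul_jam_le_jam_mul {a c : ℝ} (hc : 1 ≤ c) (ν h : ℝ) :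
    c * jam a ν h ≤ jam (c * a) ν h := by
  unfold jam
  rw [mul_max_of_nonneg _ _ (by linarith), mul_zero, mul_sub, ← mul_div_assoc, ← mul_assoc]
  gcongr
  linarith

section Expectation

/-- The capacity at the saddle point with multipliers `a` and `ν`. -/
noncomputable def meanRate (μ : Measure ℝ) (a ν : ℝ) : ℝ := ∫ h, Real.log (1 + h * snr a ν h) ∂μ

/-- The average jamming power at the saddle point with multipliers `a` and `ν`, in units of the
noise power. -/
noncomputable def meanJam (μ : Measure ℝ) (a ν : ℝ) : ℝ := ∫ h, jam a ν h ∂μ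

theorem meanJam_self {μ : Measure ℝ} (hpos : ∀ᵐ h ∂μ, 0 < h) {ν : ℝ} (hν : 0 ≤ ν) :
    meanJam μ ν ν = 0 := by
  refine integral_eq_zero_of_ae ?_
  filter_upwards [hpos] with h hh
  exact jam_self hν hh

theorem log_one_add_mul_snr_nonneg {a ν h : ℝ} (hν : 0 ≤ ν) (hh : 0 < h) :
    0 ≤ Real.log (1 + h * snr a ν h) :=
  Real.log_nonneg (le_add_of_nonneg_right (mul_nonneg hh.le (snr_nonneg hν h)))

theorem log_one_add_mul_snr_le {a ν c h : ℝ} (hν : 0 ≤ ν) (hc : ν ≤ c) (hh : 0 < h) :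
    Real.log (1 + h * snr a ν h) ≤ Real.log (1 + h) + Real.log (1 + c) := by
  have h0 := snr_nonneg (a := a) hν h
  have h1 := snr_le a ν h
  have hc0 : 0 ≤ c := hν.trans hc
  rw [← Real.log_mul (by positivity) (by positivity)]
  refine Real.log_le_log (by positivity) ?_
  nlinarith

variable {μ : Measure ℝ} [IsProbabilityMeasure μ]

theorem integrable_log_one_add_mul_snr (hpos : ∀ᵐ h ∂μ, 0 < h)
    (hlog : Integrable (fun h => Real.log (1 + h)) μ) (a : ℝ) {ν : ℝ} (hν : 0 ≤ ν) :
    Integrable (fun h => Real.log (1 + h * snr a ν h)) μ := by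
  refine (hlog.add (integrable_const (Real.log (1 + ν)))).mono' ?_ ?_
  · exact (((measurable_id.mul (measurable_snr a ν)).const_add 1).log).aestronglyMeasurable
  · filter_upwards [hpos] with h hh
    rw [Real.norm_of_nonneg (log_one_add_mul_snr_nonneg hν hh)]
    exact log_one_add_mul_snr_le hν le_rfl hh

theorem integrable_jam (hpos : ∀ᵐ h ∂μ, 0 < h) {a ν : ℝ} (ha : 0 ≤ a) (hν : 0 < ν) :
    Integrable (jam a ν) μ := by
  refine (integrable_const (a / ν)).mono' (measurable_jam a ν).aestronglyMeasurable ?_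
  filter_upwards [hpos] with h hh
  rw [Real.norm_of_nonneg (jam_nonneg a ν h)]
  exact jam_le ha hν hh

theorem continuousAt_meanRate (hpos : ∀ᵐ h ∂μ, 0 < h)
    (hlog : Integrable (fun h => Real.log (1 + h)) μ) {q : ℝ × ℝ} (hq : 0 < q.2) :
    ContinuousAt (fun q : ℝ × ℝ => meanRate μ q.1 q.2) q := by
  refine continuousAt_of_dominated (F := fun (q : ℝ × ℝ) h => Real.log (1 + h * snr q.1 q.2 h))
    (bound := fun h => Real.log (1 + h) + Real.log (1 + (q.2 + 1))) ?_ ?_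
    (hlog.add (integrable_const _)) ?_
  · exact Eventually.of_forall fun r =>
      (((measurable_id.mul (measurable_snr _ _)).const_add 1).log).aestronglyMeasurable
  · filter_upwards [continuousAt_snd.eventually (eventually_gt_nhds hq),
      continuousAt_snd.eventually (eventually_lt_nhds (lt_add_one q.2))] with r h1 h2
    filter_upwards [hpos] with h hh
    rw [Real.norm_of_nonneg (log_one_add_mul_snr_nonneg h1.le hh)]
    exact log_one_add_mul_snr_le h1.le h2.le hh
  · filter_upwards [hpos] with h hh
    have h0 : 1 + h * snr q.1 q.2 h ≠ 0 := by
      have := mul_nonneg hh.le (snr_nonneg (a := q.1) hq.le h)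
      positivity
    have h1 : Continuous fun r : ℝ × ℝ => 1 + h * snr r.1 r.2 h := by unfold snr; fun_prop
    exact h1.continuousAt.log h0

theorem continuousAt_meanJam (hpos : ∀ᵐ h ∂μ, 0 < h) {q : ℝ × ℝ} (hq1 : 0 < q.1) (hq : 0 < q.2) :
    ContinuousAt (fun q : ℝ × ℝ => meanJam μ q.1 q.2) q := by
  refine continuousAt_of_dominated (F := fun (q : ℝ × ℝ) h => jam q.1 q.2 h)
    (bound := fun _ => (q.1 + 1) / (q.2 / 2)) ?_ ?_ (integrable_const _) ?_
  · exact Eventually.of_forall fun r => (measurable_jam _ _).aestronglyMeasurable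
  · filter_upwards [continuousAt_snd.eventually (eventually_gt_nhds (half_lt_self hq)),
      continuousAt_fst.eventually (eventually_lt_nhds (lt_add_one q.1)),
      continuousAt_fst.eventually (eventually_gt_nhds hq1)] with r h1 h2 h3
    filter_upwards [hpos] with h hh
    rw [Real.norm_of_nonneg (jam_nonneg _ _ h)]
    have h4 : 0 < q.2 / 2 := by positivity
    refine (jam_le h3.le (h4.trans h1) hh).trans ?_
    gcongr
  · filter_upwards [hpos] with h hh
    have h0 : 1 + q.2 * h ≠ 0 := by positivity
    have h1 : ContinuousAt (fun r : ℝ × ℝ => r.1 * h / (1 + r.2 * h)) q :=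
      ContinuousAt.div (by fun_prop) (by fun_prop) h0
    exact (h1.sub continuousAt_const).max continuousAt_const

theorem exists_half_le_measure_Ici (hpos : ∀ᵐ h ∂μ, 0 < h) :
    ∃ h₀, 0 < h₀ ∧ 1 / 2 ≤ μ.real (Set.Ici h₀) := by
  have h1 : Tendsto (fun n : ℕ => μ (Set.Ici (1 / ((n : ℝ) + 1)))) atTop
      (𝓝 (μ (⋃ n : ℕ, Set.Ici (1 / ((n : ℝ) + 1))))) := by
    refine tendsto_measure_iUnion_atTop fun m n hmn => Set.Ici_subset_Ici.2 ?_
    exact Nat.one_div_le_one_div hmn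
  have h2 : μ (⋃ n : ℕ, Set.Ici (1 / ((n : ℝ) + 1))) = 1 := by
    rw [← prob_compl_eq_zero_iff (MeasurableSet.iUnion fun n => measurableSet_Ici)]
    refine measure_mono_null ?_ (ae_iff.1 hpos)
    intro h hh (h0 : 0 < h)
    refine hh ?_
    obtain ⟨n, hn⟩ := exists_nat_one_div_lt h0
    exact Set.mem_iUnion.2 ⟨n, hn.le⟩
  rw [h2] at h1
  have h3 : (ENNReal.ofReal (1 / 2)) < 1 := by
    rw [← ENNReal.ofReal_one]
    exact (ENNReal.ofReal_lt_ofReal_iff one_pos).2 (by norm_num)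
  obtain ⟨n, hn⟩ := (h1.eventually (eventually_gt_nhds h3)).exists
  refine ⟨1 / ((n : ℝ) + 1), by positivity, ?_⟩
  exact (ENNReal.ofReal_le_iff_le_toReal (measure_ne_top _ _)).1 hn.le

/-- A form of Markov's inequality, at a threshold that the gain reaches with probability at least
one half. -/
theorem half_mul_le_integral {f : ℝ → ℝ} (hf : Integrable f μ) (hf0 : 0 ≤ᵐ[μ] f) {h₀ c : ℝ}
    (hh₀ : 1 / 2 ≤ μ.real (Set.Ici h₀)) (hc : 0 ≤ c) (hfc : ∀ h, h₀ ≤ h → c ≤ f h) :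
    1 / 2 * c ≤ ∫ h, f h ∂μ := by
  have h1 : μ.real (Set.Ici h₀) * c ≤ ∫ h in Set.Ici h₀, f h ∂μ := by
    have := setIntegral_mono_on (integrable_const c).integrableOn hf.integrableOn
      measurableSet_Ici (fun h hh => hfc h hh) (s := Set.Ici h₀) (μ := μ)
    simpa using this
  calc 1 / 2 * c ≤ μ.real (Set.Ici h₀) * c := by gcongr
    _ ≤ ∫ h in Set.Ici h₀, f h ∂μ := h1
    _ ≤ ∫ h, f h ∂μ := setIntegral_le_integral hf hf0

theorem meanJam_lt_meanJam (hpos : ∀ᵐ h ∂μ, 0 < h) {a b ν : ℝ} (ha : 0 < a) (hab : a < b)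
    (hν : 0 < ν) (hj : 0 < meanJam μ a ν) : meanJam μ a ν < meanJam μ b ν := by
  have h1 : 1 < b / a := (one_lt_div ha).2 hab
  calc meanJam μ a ν < b / a * meanJam μ a ν := lt_mul_of_one_lt_left hj h1
    _ = ∫ h, b / a * jam a ν h ∂μ := (integral_const_mul _ _).symm
    _ ≤ meanJam μ b ν := by
      refine integral_mono ((integrable_jam hpos ha.le hν).const_mul _)
        (integrable_jam hpos (ha.trans hab).le hν) fun h => ?_
      have := mul_jam_le_jam_mul (a := a) h1.le ν h
      rwa [div_mul_cancel₀ _ ha.ne'] at this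

theorem exists_meanJam_eq (hpos : ∀ᵐ h ∂μ, 0 < h) {j ν : ℝ} (hj : 0 ≤ j) (hν : 0 < ν) :
    ∃ a, ν ≤ a ∧ meanJam μ a ν = j := by
  obtain ⟨h₀, h₀pos, hh₀⟩ := exists_half_le_measure_Ici hpos
  -- at this level the jamming power is at least `2 * j` for all gains above `h₀`
  set b := ν + (2 * j + 1) * (1 + ν * h₀) / h₀ with hb
  have hνb : ν ≤ b := le_add_of_nonneg_right (by positivity)
  have h1 : j ≤ meanJam μ b ν := by
    have := half_mul_le_integral (integrable_jam hpos (hν.le.trans hνb) hν)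
      (Eventually.of_forall (jam_nonneg b ν)) hh₀ (c := 2 * j) (by positivity) ?_
    · change _ ≤ meanJam μ b ν at this
      linarith
    · intro h hh
      have hh0 : 0 < h := h₀pos.trans_le hh
      refine le_max_of_le_left ?_
      rw [le_sub_iff_add_le, le_div_iff₀ (by positivity)]
      have h2 : (2 * j + 1) * (1 + ν * h) ≤ (2 * j + 1) * (1 + ν * h₀) / h₀ * h := by
        rw [div_mul_eq_mul_div, le_div_iff₀ h₀pos]
        have : (1 + ν * h) * h₀ ≤ (1 + ν * h₀) * h := by nlinarith
        nlinarith
      have : 0 ≤ ν * h := by positivity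
      rw [hb, add_mul]
      linarith
  have h2 : ContinuousOn (fun a => meanJam μ a ν) (Set.Icc ν b) := fun a ha =>
    (ContinuousAt.comp (f := fun a : ℝ => (a, ν))
      (continuousAt_meanJam hpos (q := (a, ν)) (hν.trans_le ha.1) hν)
      (by fun_prop)).continuousWithinAt
  obtain ⟨a, ha, hja⟩ := intermediate_value_Icc hνb h2 (show j ∈ _ by
    rw [Set.mem_Icc, meanJam_self hpos hν.le]
    exact ⟨hj, h1⟩)
  exact ⟨a, ha.1, hja⟩

/-- The level that makes the average jamming power equal to `j` depends continuously on `ν`. -/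
theorem exists_continuousOn_meanJam_eq (hpos : ∀ᵐ h ∂μ, 0 < h) {j : ℝ} (hj : 0 ≤ j) :
    ∃ a : ℝ → ℝ, ContinuousOn a (Set.Ioi 0) ∧ ∀ ν, 0 < ν → ν ≤ a ν ∧ meanJam μ (a ν) ν = j := by
  rcases hj.eq_or_lt with rfl | hj
  -- for `j = 0` the level is not unique, and `a ν = ν` is a continuous choice
  · exact ⟨id, continuousOn_id, fun ν hν => ⟨le_rfl, meanJam_self hpos hν.le⟩⟩
  have h1 : ∀ ν : ℝ, ∃ a, 0 < ν → ν ≤ a ∧ meanJam μ a ν = j := fun ν => by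
    by_cases hν : 0 < ν
    · obtain ⟨a, ha⟩ := exists_meanJam_eq hpos hj.le hν
      exact ⟨a, fun _ => ha⟩
    · exact ⟨0, fun h => absurd h hν⟩
  choose a ha using h1
  refine ⟨a, fun ν hν => ContinuousAt.continuousWithinAt ?_, ha⟩
  have hν : 0 < ν := hν
  have haν := (ha ν hν).1
  have hcont (b : ℝ) (hb : 0 < b) : ContinuousAt (fun ν => meanJam μ b ν) ν :=
    ContinuousAt.comp (f := fun ν : ℝ => (b, ν)) (continuousAt_meanJam hpos (q := (b, ν)) hb hν)
      (by fun_prop)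
  have hmono {b c ν : ℝ} (hν : 0 < ν) (hb : 0 ≤ b) (hbc : b ≤ c) :
      meanJam μ b ν ≤ meanJam μ c ν := by
    refine integral_mono_ae (integrable_jam hpos hb hν) (integrable_jam hpos (hb.trans hbc) hν) ?_
    filter_upwards [hpos] with h hh
    exact jam_mono_left hν.le hh hbc
  refine tendsto_order.2 ⟨fun b hb => ?_, fun b hb => ?_⟩
  · -- a positive level `c` between `b` and `a ν`
    obtain ⟨c, hc, hca⟩ := exists_between (max_lt hb (hν.trans_le haν))
    have hc0 : 0 < c := (le_max_right _ _).trans_lt hc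
    have hcj : meanJam μ c ν < j := by
      by_contra! h
      have := meanJam_lt_meanJam hpos hc0 hca hν (hj.trans_le h)
      rw [(ha ν hν).2] at this
      linarith
    filter_upwards [(hcont c hc0).eventually (eventually_lt_nhds hcj), eventually_gt_nhds hν]
      with κ h1 h2
    by_contra! h
    have h3 := hmono h2 (h2.le.trans (ha κ h2).1) (h.trans ((le_max_left _ _).trans hc.le))
    rw [(ha κ h2).2] at h3
    linarith
  · have hb0 : 0 < b := hν.trans_le (haν.trans hb.le)
    have hbj : j < meanJam μ b ν := by
      have := meanJam_lt_meanJam hpos (hν.trans_le haν) hb hν (by rw [(ha ν hν).2]; exact hj)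
      rwa [(ha ν hν).2] at this
    filter_upwards [(hcont b hb0).eventually (eventually_gt_nhds hbj), eventually_gt_nhds hν]
      with κ h1 h2
    by_contra! h
    have h3 := hmono h2 hb0.le h
    rw [(ha κ h2).2] at h3
    linarith

theorem exists_meanRate_lt (hpos : ∀ᵐ h ∂μ, 0 < h)
    (hlog : Integrable (fun h => Real.log (1 + h)) μ) (a : ℝ → ℝ) {R : ℝ} (hR : 0 < R) :
    ∃ ν, 0 < ν ∧ meanRate μ (a ν) ν < R := by
  have h1 : Tendsto (fun ν => ∫ h, Real.log (1 + h * snr (a ν) ν h) ∂μ) (𝓝[>] 0)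
      (𝓝 (∫ _, (0 : ℝ) ∂μ)) := by
    refine tendsto_integral_filter_of_dominated_convergence
      (fun h => Real.log (1 + h) + Real.log (1 + 1)) ?_ ?_ (hlog.add (integrable_const _)) ?_
    · exact Eventually.of_forall fun r =>
        (((measurable_id.mul (measurable_snr _ _)).const_add 1).log).aestronglyMeasurable
    · filter_upwards [self_mem_nhdsWithin, nhdsWithin_le_nhds (eventually_lt_nhds one_pos)]
        with ν h1 h2
      filter_upwards [hpos] with h hh
      rw [Real.norm_of_nonneg (log_one_add_mul_snr_nonneg (le_of_lt h1) hh)]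
      exact log_one_add_mul_snr_le (le_of_lt h1) h2.le hh
    · filter_upwards [hpos] with h hh
      have h2 : Tendsto (fun ν => Real.log (1 + h * ν)) (𝓝[>] 0) (𝓝 0) := by
        have : ContinuousAt (fun ν => Real.log (1 + h * ν)) 0 :=
          ContinuousAt.log (by fun_prop) (by simp)
        have h3 := this.tendsto.mono_left (nhdsWithin_le_nhds (s := Set.Ioi 0))
        simpa using h3
      refine tendsto_of_tendsto_of_tendsto_of_le_of_le' tendsto_const_nhds h2 ?_ ?_
      · filter_upwards [self_mem_nhdsWithin] with ν hν
        exact log_one_add_mul_snr_nonneg (le_of_lt hν) hh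
      · filter_upwards [self_mem_nhdsWithin] with ν hν
        have h3 := mul_nonneg hh.le (snr_nonneg (a := a ν) (le_of_lt hν) h)
        have h4 := mul_le_mul_of_nonneg_left (snr_le (a ν) ν h) hh.le
        exact Real.log_le_log (by linarith) (by linarith)
  rw [integral_zero] at h1
  obtain ⟨ν, h2, h3⟩ := ((h1.eventually (eventually_lt_nhds hR)).and self_mem_nhdsWithin).exists
  exact ⟨ν, h3, h2⟩

theorem exists_le_meanRate (hpos : ∀ᵐ h ∂μ, 0 < h)
    (hlog : Integrable (fun h => Real.log (1 + h)) μ) {a : ℝ → ℝ} (ha : ∀ ν, 0 < ν → ν ≤ a ν)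
    {R : ℝ} (hR : 0 < R) : ∃ ν, 0 < ν ∧ R ≤ meanRate μ (a ν) ν := by
  obtain ⟨h₀, h₀pos, hh₀⟩ := exists_half_le_measure_Ici hpos
  -- for this multiplier the rate is at least `2 * R` for all gains above `h₀`
  have hν : 0 < Real.exp (2 * R) / h₀ := by positivity
  refine ⟨_, hν, ?_⟩
  have := half_mul_le_integral
    (integrable_log_one_add_mul_snr hpos hlog (a (Real.exp (2 * R) / h₀)) hν.le)
    (by filter_upwards [hpos] with h hh using log_one_add_mul_snr_nonneg hν.le hh) hh₀
    (c := 2 * R) (by positivity) ?_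
  · change _ ≤ meanRate μ _ _ at this
    linarith
  · intro h hh
    have hh0 : 0 < h := h₀pos.trans_le hh
    have h1 := snr_mono_left (ha _ hν) (Real.exp (2 * R) / h₀) h
    have h2 : Real.exp (2 * R) / h₀ - 1 / h ≤
        snr (Real.exp (2 * R) / h₀) (Real.exp (2 * R) / h₀) h :=
      le_min (sub_le_self _ (by positivity)) (le_max_left _ _)
    have h5 := mul_nonneg hh0.le (snr_nonneg (a := a (Real.exp (2 * R) / h₀)) hν.le h)
    rw [Real.le_log_iff_exp_le (by positivity)]
    have h3 := mul_le_mul_of_nonneg_left (h2.trans h1) hh0.le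
    rw [mul_sub, mul_one_div_cancel hh0.ne'] at h3
    have h4 : Real.exp (2 * R) ≤ h * (Real.exp (2 * R) / h₀) := by
      rw [mul_div_assoc', le_div_iff₀ h₀pos, mul_comm]
      gcongr
    linarith

/-- The multipliers of the saddle point exist: the jammer spends the power `j` and the transmitter
achieves the rate `R`. -/
theorem exists_multipliers (hpos : ∀ᵐ h ∂μ, 0 < h)
    (hlog : Integrable (fun h => Real.log (1 + h)) μ) {j R : ℝ} (hj : 0 ≤ j) (hR : 0 < R) :
    ∃ a ν, 0 < a ∧ 0 < ν ∧ meanJam μ a ν = j ∧ meanRate μ a ν = R := by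
  obtain ⟨a, hac, ha⟩ := exists_continuousOn_meanJam_eq hpos hj
  obtain ⟨ν₁, hν₁, h1⟩ := exists_meanRate_lt hpos hlog a hR
  obtain ⟨ν₂, hν₂, h2⟩ := exists_le_meanRate hpos hlog (fun ν hν => (ha ν hν).1) hR
  have hcont : ContinuousOn (fun ν => meanRate μ (a ν) ν) (Set.Ioi 0) := fun ν hν => by
    have h3 : ContinuousWithinAt (fun ν => (a ν, ν)) (Set.Ioi 0) ν :=
      (hac ν hν).prodMk continuousWithinAt_id
    exact (continuousAt_meanRate hpos hlog (q := (a ν, ν)) hν).comp_continuousWithinAt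
      (f := fun ν => (a ν, ν)) h3
  obtain ⟨ν, hν, h3⟩ := isPreconnected_Ioi.intermediate_value hν₁ hν₂ hcont ⟨h1.le, h2⟩
  exact ⟨a ν, ν, (show 0 < ν from hν).trans_le (ha ν hν).1, hν, (ha ν hν).2, h3⟩

end Expectation

/-! ### Replies and water-filling within a frame -/

variable {p : ℝ → ℝ} {N R : ℝ}

theorem IsGainPDF.isProbabilityMeasure (hp : IsGainPDF p) :
    IsProbabilityMeasure (gainMeasure p) :=
  ⟨by rw [gainMeasure, withDensity_apply _ MeasurableSet.univ, setLIntegral_univ,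
    hp.lintegral_eq_one]⟩

theorem IsGainPDF.ae_pos (hp : IsGainPDF p) : ∀ᵐ h ∂(gainMeasure p), 0 < h := by
  rw [gainMeasure, ae_withDensity_iff hp.measurable.ennreal_ofReal]
  filter_upwards [Measure.ae_ne volume (0 : ℝ)] with h h0 hne
  refine lt_of_le_of_ne (not_lt.1 fun hlt => hne ?_) h0.symm
  rw [hp.eq_zero_of_neg h hlt, ENNReal.ofReal_zero]

/-- The answer to the jamming `J` that keeps the ratio of signal power to total noise equal to
`y`, whatever `J` is. -/
noncomputable def reply (N : ℝ) (y J : ℝ → ℝ≥0) (h : ℝ) : ℝ≥0 := y h * (N.toNNReal + J h)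

/-- The capacity of a reply depends on `y` alone. -/
theorem capacity_reply (hN : 0 < N) (y J : ℝ → ℝ≥0) : capacity p N (reply N y J) J =
    ∫⁻ h, ENNReal.ofReal (Real.log (1 + h * (y h : ℝ))) ∂(gainMeasure p) := by
  refine lintegral_congr fun h => ?_
  have : N + (J h : ℝ) ≠ 0 := by positivity
  rw [reply, NNReal.coe_mul, NNReal.coe_add, Real.coe_toNNReal _ hN.le, ← mul_assoc,
    mul_div_assoc, div_self this, mul_one]

theorem framePower_reply {y J : ℝ → ℝ≥0} (hy : Measurable y) : framePower p (reply N y J) =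
    N.toNNReal * (∫⁻ h, (y h : ℝ≥0∞) ∂(gainMeasure p)) +
      ∫⁻ h, (y h : ℝ≥0∞) * (J h : ℝ≥0∞) ∂(gainMeasure p) := by
  rw [← lintegral_const_mul _ hy.coe_nnreal_ennreal, ← lintegral_add_left (by fun_prop)]
  refine lintegral_congr fun h => ?_
  rw [reply]
  push_cast
  ring

/-- Concavity of the logarithm: if the power `P` fills up the noise `n` to the level `c * h`, then
changing `P` to `Q` does not increase the rate by more than `(Q - P) / c`. -/
theorem log_add_le_log_add_of_fill {c h n P Q : ℝ} (hc : 0 < c) (hh : 0 < h) (hn : 0 < n)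
    (hP : 0 ≤ P) (hQ : 0 ≤ Q) (hle : c * h ≤ n + h * P) (heq : P ≠ 0 → n + h * P = c * h) :
    Real.log (1 + h * Q / n) + P / c ≤ Real.log (1 + h * P / n) + Q / c := by
  have hu : 0 < 1 + h * Q / n := by positivity
  have hv : 0 < 1 + h * P / n := by positivity
  have hd : 0 < n + h * P := by positivity
  have h1 := Real.log_le_sub_one_of_pos (div_pos hu hv)
  rw [Real.log_div hu.ne' hv.ne'] at h1
  have h2 : (1 + h * Q / n) / (1 + h * P / n) - 1 = h * (Q - P) / (n + h * P) := by
    field_simp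
    ring
  have h3 : h * (Q - P) / (n + h * P) ≤ Q / c - P / c := by
    by_cases h0 : P = 0
    · subst h0
      rw [zero_div, sub_zero, sub_zero, div_le_div_iff₀ hd hc]
      nlinarith
    · rw [heq h0]
      apply le_of_eq
      field_simp
  linarith

/-- Water-filling: an allocation that fills up the noise to a constant level needs the least
power among all allocations that achieve its capacity. -/
theorem framePower_le_of_fill (hp : IsGainPDF p) (hN : 0 < N) {c : ℝ} (hc : 0 < c)
    {P Q J : ℝ → ℝ≥0} (hP : Measurable P) (hQ : Measurable Q)
    (hle : ∀ᵐ h ∂(gainMeasure p), c * h ≤ N + J h + h * P h)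
    (heq : ∀ᵐ h ∂(gainMeasure p), P h ≠ 0 → N + J h + h * P h = c * h)
    (htop : capacity p N P J ≠ ⊤) (hcap : capacity p N P J ≤ capacity p N Q J) :
    framePower p P ≤ framePower p Q := by
  have hscale (A : ℝ → ℝ≥0) (hA : Measurable A) :
      ∫⁻ h, ENNReal.ofReal ((A h : ℝ) / c) ∂(gainMeasure p) =
        framePower p A * ENNReal.ofReal c⁻¹ := by
    rw [framePower, ← lintegral_mul_const _ hA.coe_nnreal_ennreal]
    refine lintegral_congr fun h => ?_
    rw [div_eq_mul_inv, ENNReal.ofReal_mul (A h).coe_nonneg, ENNReal.ofReal_coe_nnreal]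
  have hsum : capacity p N Q J + framePower p P * ENNReal.ofReal c⁻¹ ≤
      capacity p N P J + framePower p Q * ENNReal.ofReal c⁻¹ := by
    rw [← hscale P hP, ← hscale Q hQ, capacity, capacity,
      ← lintegral_add_right _ (by fun_prop), ← lintegral_add_right _ (by fun_prop)]
    refine lintegral_mono_ae ?_
    filter_upwards [hp.ae_pos, hle, heq] with h hh h1 h2
    have hn : 0 < N + (J h : ℝ) := by positivity
    have hlog (A : ℝ≥0) : 0 ≤ Real.log (1 + h * (A : ℝ) / (N + (J h : ℝ))) :=
      Real.log_nonneg (le_add_of_nonneg_right (by positivity))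
    rw [← ENNReal.ofReal_add (hlog _) (by positivity), ← ENNReal.ofReal_add (hlog _) (by positivity)]
    refine ENNReal.ofReal_le_ofReal (log_add_le_log_add_of_fill hc hh hn (P h).2 (Q h).2 h1 ?_)
    exact fun h3 => h2 fun h4 => h3 (by rw [h4]; rfl)
  have h1 := (ENNReal.add_le_add_iff_left htop).1 ((add_le_add_left hcap _).trans hsum)
  rwa [ENNReal.mul_le_mul_iff_left (by simpa using hc) ENNReal.ofReal_ne_top] at h1

theorem minPower_le (P J : ℝ → ℝ≥0) (hP : Measurable P)
    (hcap : ENNReal.ofReal R ≤ capacity p N P J) : minPower p N R J ≤ framePower p P :=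
  iInf_le_of_le P (iInf_le_of_le hP (iInf_le _ hcap))

/-! ### The saddle point of the game within a frame -/

/-- A saddle point of the game within a frame, in which the jammer has the power `j`. The jammer
plays `J`, the transmitter keeps the ratio of its power to the total noise equal to `y`; this ratio
is at most `ν`, and equal to `ν` wherever the jammer is active. -/
structure IsSaddlePoint (p : ℝ → ℝ) (N R : ℝ) (j : ℝ≥0) (y J : ℝ → ℝ≥0) (ν : ℝ≥0) : Prop where
  measurable_snr : Measurable y
  measurable_jam : Measurable J
  snr_le : ∀ h, y h ≤ ν
  snr_eq : ∀ᵐ h ∂(gainMeasure p), J h ≠ 0 → y h = ν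
  rate_eq : ∫⁻ h, ENNReal.ofReal (Real.log (1 + h * (y h : ℝ))) ∂(gainMeasure p) =
    ENNReal.ofReal R
  framePower_jam : framePower p J = j
  minPower_jam : minPower p N R J = framePower p (reply N y J)

theorem exists_isSaddlePoint (hp : IsGainPDF p)
    (hlog : Integrable (fun h => Real.log (1 + h)) (gainMeasure p)) (hN : 0 < N) (hR : 0 < R)
    (j : ℝ≥0) : ∃ y J ν, IsSaddlePoint p N R j y J ν := by
  have := hp.isProbabilityMeasure
  have hpos := hp.ae_pos
  obtain ⟨a, ν, ha, hν, hj, hr⟩ :=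
    exists_multipliers hpos hlog (j := j / N) (R := R) (by positivity) hR
  set y : ℝ → ℝ≥0 := fun h => (snr a ν h).toNNReal with hy
  set J : ℝ → ℝ≥0 := fun h => (N * jam a ν h).toNNReal with hJ
  have hym : Measurable y := (measurable_snr a ν).real_toNNReal
  have hJm : Measurable J := ((measurable_jam a ν).const_mul N).real_toNNReal
  have hyc (h : ℝ) : (y h : ℝ) = snr a ν h := Real.coe_toNNReal _ (snr_nonneg hν.le h)
  have hJc (h : ℝ) : (J h : ℝ) = N * jam a ν h :=
    Real.coe_toNNReal _ (mul_nonneg hN.le (jam_nonneg a ν h))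
  have hrate : ∫⁻ h, ENNReal.ofReal (Real.log (1 + h * (y h : ℝ))) ∂(gainMeasure p) =
      ENNReal.ofReal R := by
    simp_rw [hyc]
    rw [← hr, meanRate, ofReal_integral_eq_lintegral_ofReal
      (integrable_log_one_add_mul_snr hpos hlog a hν.le)]
    filter_upwards [hpos] with h hh using log_one_add_mul_snr_nonneg hν.le hh
  have hrm : Measurable (reply N y J) := hym.mul (hJm.const_add _)
  have hPc (h : ℝ) : (reply N y J h : ℝ) = snr a ν h * (N + N * jam a ν h) := by
    rw [reply, NNReal.coe_mul, NNReal.coe_add, Real.coe_toNNReal _ hN.le, hyc, hJc]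
  refine ⟨y, J, ν.toNNReal, hym, hJm, fun h => Real.toNNReal_le_toNNReal (snr_le a ν h), ?_,
    hrate, ?_, ?_⟩
  · filter_upwards [hpos] with h hh h0
    have : jam a ν h ≠ 0 := fun h1 => h0 (by simp [hJ, h1])
    change (snr a ν h).toNNReal = _
    rw [snr_eq_of_jam_ne_zero hν hh this]
  · have h1 : framePower p J = ENNReal.ofReal (∫ h, N * jam a ν h ∂(gainMeasure p)) := by
      rw [ofReal_integral_eq_lintegral_ofReal ((integrable_jam hpos ha.le hν).const_mul N)
        (Filter.Eventually.of_forall fun h => mul_nonneg hN.le (jam_nonneg a ν h))]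
      rfl
    rw [meanJam] at hj
    rw [h1, integral_const_mul, hj, mul_div_cancel₀ _ hN.ne', ENNReal.ofReal_coe_nnreal]
  · have hcap := (capacity_reply (p := p) hN y J).trans hrate
    refine le_antisymm (minPower_le _ _ hrm hcap.ge) ?_
    refine le_iInf fun Q => le_iInf fun hQ => le_iInf fun hQcap => ?_
    refine framePower_le_of_fill hp hN (c := a * N) (by positivity) hrm hQ ?_ ?_
      (by rw [hcap]; exact ENNReal.ofReal_ne_top) (by rw [hcap]; exact hQcap)
    · filter_upwards [hpos] with h hh
      rw [hPc, hJc]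
      have := mul_le_mul_of_nonneg_left (mul_le_fill (a := a) hν hh) hN.le
      linarith
    · filter_upwards [hpos] with h hh h0
      have hs : 0 < snr a ν h := by
        refine (snr_nonneg hν.le h).lt_of_ne fun h1 => h0 ?_
        rw [← NNReal.coe_eq_zero, hPc, ← h1, zero_mul]
      rw [hPc, hJc]
      linear_combination N * fill_eq hν hh hs

namespace IsSaddlePoint

variable {j : ℝ≥0} {y J : ℝ → ℝ≥0} {ν : ℝ≥0}

theorem capacity_reply (h : IsSaddlePoint p N R j y J ν) (hN : 0 < N) (J' : ℝ → ℝ≥0) :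
    capacity p N (reply N y J') J' = ENNReal.ofReal R :=
  (Jamming.capacity_reply hN y J').trans h.rate_eq

theorem measurable_reply (h : IsSaddlePoint p N R j y J ν) {J' : ℝ → ℝ≥0} (hJ' : Measurable J') :
    Measurable (reply N y J') :=
  h.measurable_snr.mul (hJ'.const_add _)

theorem framePower_reply_le (h : IsSaddlePoint p N R j y J ν) (J' : ℝ → ℝ≥0) :
    framePower p (reply N y J') ≤
      N.toNNReal * (∫⁻ h, (y h : ℝ≥0∞) ∂(gainMeasure p)) + ν * framePower p J' := by
  rw [framePower_reply h.measurable_snr, framePower,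
    ← lintegral_const_mul' (ν : ℝ≥0∞) _ ENNReal.coe_ne_top]
  refine add_le_add le_rfl (lintegral_mono fun x => ?_)
  gcongr
  exact h.snr_le x

theorem framePower_reply_jam (h : IsSaddlePoint p N R j y J ν) :
    framePower p (reply N y J) =
      N.toNNReal * (∫⁻ h, (y h : ℝ≥0∞) ∂(gainMeasure p)) + ν * j := by
  rw [framePower_reply h.measurable_snr, ← h.framePower_jam, framePower,
    ← lintegral_const_mul' (ν : ℝ≥0∞) _ ENNReal.coe_ne_top]
  congr 1
  refine lintegral_congr_ae ?_
  filter_upwards [h.snr_eq] with x hx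
  by_cases h0 : J x = 0
  · simp [h0]
  · rw [hx h0]

theorem requiredPower_eq_minPower (h : IsSaddlePoint p N R j y J ν) (hN : 0 < N) :
    requiredPower p N R j = minPower p N R J := by
  refine le_antisymm (iSup_le fun J' => iSup_le fun hJ' => iSup_le fun hj => ?_)
    (le_iSup_of_le J (le_iSup_of_le h.measurable_jam (le_iSup_of_le h.framePower_jam.le le_rfl)))
  refine (minPower_le _ _ (h.measurable_reply hJ') (h.capacity_reply hN J').ge).trans ?_
  rw [h.minPower_jam, h.framePower_reply_jam]
  refine (h.framePower_reply_le J').trans ?_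
  gcongr

/-- The required power is the value at `j` of the affine bound `framePower_reply_le`, so that `ν` is
a supergradient of the required power at `j`. -/
theorem requiredPower_eq (h : IsSaddlePoint p N R j y J ν) (hN : 0 < N) :
    requiredPower p N R j =
      N.toNNReal * (∫⁻ h, (y h : ℝ≥0∞) ∂(gainMeasure p)) + ν * j := by
  rw [h.requiredPower_eq_minPower hN, h.minPower_jam, h.framePower_reply_jam]

theorem requiredPower_lt_top (h : IsSaddlePoint p N R j y J ν) (hp : IsGainPDF p) (hN : 0 < N) :
    requiredPower p N R j < ⊤ := by
  have := hp.isProbabilityMeasure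
  have h1 : ∫⁻ h, (y h : ℝ≥0∞) ∂(gainMeasure p) ≤ ν := by
    calc ∫⁻ h, (y h : ℝ≥0∞) ∂(gainMeasure p) ≤ ∫⁻ _, (ν : ℝ≥0∞) ∂(gainMeasure p) :=
          lintegral_mono fun x => ENNReal.coe_le_coe.2 (h.snr_le x)
      _ = ν := by simp
  rw [h.requiredPower_eq hN]
  exact ENNReal.add_lt_top.2 ⟨ENNReal.mul_lt_top ENNReal.coe_lt_top
    (h1.trans_lt ENNReal.coe_lt_top), ENNReal.mul_lt_top ENNReal.coe_lt_top ENNReal.coe_lt_top⟩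

theorem requiredPower_pos (h : IsSaddlePoint p N R j y J ν) (hN : 0 < N) (hR : 0 < R) :
    0 < requiredPower p N R j := by
  rw [h.requiredPower_eq hN, pos_iff_ne_zero]
  intro h0
  have h1 : ∫⁻ h, (y h : ℝ≥0∞) ∂(gainMeasure p) = 0 := by
    simpa [hN.not_ge] using (add_eq_zero.1 h0).1
  rw [lintegral_eq_zero_iff h.measurable_snr.coe_nnreal_ennreal] at h1
  have h2 : ∫⁻ h, ENNReal.ofReal (Real.log (1 + h * (y h : ℝ))) ∂(gainMeasure p) = 0 := by
    rw [← lintegral_zero]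
    refine lintegral_congr_ae ?_
    filter_upwards [h1] with x hx
    have : y x = 0 := by simpa using hx
    simp [this]
  rw [h.rate_eq, ENNReal.ofReal_eq_zero] at h2
  linarith

end IsSaddlePoint

/-! ### Strategies over all frames -/

theorem measurable_framePower_strategy (hp : IsGainPDF p) {s : Strategy}
    (hs : Measurable (Function.uncurry s)) : Measurable fun ω => framePower p (s ω) := by
  have := hp.isProbabilityMeasure
  exact hs.coe_nnreal_ennreal.lintegral_prod_right'

theorem measurable_capacity_strategy (hp : IsGainPDF p) {P J : Strategy}
    (hP : Measurable (Function.uncurry P)) (hJ : Measurable (Function.uncurry J)) :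
    Measurable fun ω => capacity p N (P ω) (J ω) := by
  have := hp.isProbabilityMeasure
  have : Measurable fun x : unitInterval × ℝ => ENNReal.ofReal (Real.log
      (1 + x.2 * ((Function.uncurry P x : ℝ≥0) : ℝ) /
        (N + ((Function.uncurry J x : ℝ≥0) : ℝ)))) := by
    fun_prop
  exact this.lintegral_prod_right'

theorem measurableSet_rate_le_capacity (hp : IsGainPDF p) {P J : Strategy}
    (hP : Measurable (Function.uncurry P)) (hJ : Measurable (Function.uncurry J)) :
    MeasurableSet {ω | ENNReal.ofReal R ≤ capacity p N (P ω) (J ω)} :=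
  measurableSet_le measurable_const (measurable_capacity_strategy hp hP hJ)

theorem outage_eq (hp : IsGainPDF p) {P J : Strategy}
    (hP : Measurable (Function.uncurry P)) (hJ : Measurable (Function.uncurry J)) :
    outage p N R P J = 1 - volume {ω | ENNReal.ofReal R ≤ capacity p N (P ω) (J ω)} := by
  rw [← prob_compl_eq_one_sub (measurableSet_rate_le_capacity hp hP hJ), outage]
  congr 1
  ext ω
  simp

theorem onFraction_le_one (p : ℝ → ℝ) (N R : ℝ) (Pbar j : ℝ≥0) : onFraction p N R Pbar j ≤ 1 :=
  min_le_left _ _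

theorem onFraction_mul_le (p : ℝ → ℝ) (N R : ℝ) (Pbar j : ℝ≥0) :
    onFraction p N R Pbar j * requiredPower p N R j ≤ Pbar :=
  (mul_le_mul_left (min_le_right _ _) _).trans (by rw [mul_comm]; exact ENNReal.mul_div_le)

/-- Each active frame costs at least `requiredPower` against uniform jamming. -/
theorem IsUniformJamming.volume_le_onFraction {Pbar j : ℝ≥0} {J P : Strategy}
    (hJ : IsUniformJamming p N R j J) (hp : IsGainPDF p) (hpos : 0 < requiredPower p N R j)
    (htop : requiredPower p N R j < ⊤) (hP : Admissible p Pbar P) :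
    volume {ω | ENNReal.ofReal R ≤ capacity p N (P ω) (J ω)} ≤ onFraction p N R Pbar j := by
  refine le_min prob_le_one ?_
  rw [ENNReal.le_div_iff_mul_le (Or.inl hpos.ne') (Or.inl htop.ne), mul_comm, ← setLIntegral_const]
  refine le_trans (setLIntegral_mono' (measurableSet_rate_le_capacity hp hP.1 hJ.1) ?_)
    ((setLIntegral_le_lintegral _ _).trans hP.2)
  intro ω hω
  rw [← (hJ.2 ω).2]
  exact minPower_le _ _ hP.1.of_uncurry_left hω

theorem IsUniformJamming.one_sub_onFraction_le_outage {Pbar j : ℝ≥0} {J P : Strategy}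
    (hJ : IsUniformJamming p N R j J) (hp : IsGainPDF p) (hpos : 0 < requiredPower p N R j)
    (htop : requiredPower p N R j < ⊤) (hP : Admissible p Pbar P) :
    1 - onFraction p N R Pbar j ≤ outage p N R P J := by
  rw [outage_eq hp hP.1 hJ.1]
  exact tsub_le_tsub_left (hJ.volume_le_onFraction hp hpos htop hP) _

theorem IsUniformJamming.admissible {j : ℝ≥0} {J : Strategy} (hJ : IsUniformJamming p N R j J) :
    Admissible p j J := by
  refine ⟨hJ.1, ?_⟩
  simp_rw [fun ω => (hJ.2 ω).1]
  simp

theorem measurable_uncurry_indicator {S : Set unitInterval} (hS : MeasurableSet S) {s : Strategy}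
    (hs : Measurable (Function.uncurry s)) : Measurable (Function.uncurry (S.indicator s)) := by
  have : Function.uncurry (S.indicator s) =
      (Prod.fst ⁻¹' S).indicator (Function.uncurry s) := by
    ext ⟨ω, h⟩
    by_cases hω : ω ∈ S <;> simp [Function.uncurry, hω]
  rw [this]
  exact hs.indicator (measurable_fst hS)

theorem framePower_zero (p : ℝ → ℝ) : framePower p 0 = 0 := by simp [framePower]

theorem framePower_indicator (p : ℝ → ℝ) (S : Set unitInterval) (s : Strategy) :
    (fun ω => framePower p (S.indicator s ω)) = S.indicator fun ω => framePower p (s ω) := by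
  ext ω
  by_cases hω : ω ∈ S <;> simp [hω, framePower_zero]

theorem IsSaddlePoint.measurable_uncurry_reply {j : ℝ≥0} {y J : ℝ → ℝ≥0} {ν : ℝ≥0}
    (h : IsSaddlePoint p N R j y J ν) {J' : Strategy} (hJ' : Measurable (Function.uncurry J')) :
    Measurable (Function.uncurry fun ω => reply N y (J' ω)) :=
  (h.measurable_snr.comp measurable_snd).mul (hJ'.const_add _)

/-- Whatever the jammer does, the transmitter can reply with the ratio `y` of the saddle point in a
suitable set of frames. -/
theorem IsSaddlePoint.securedOutage_le {j Pbar : ℝ≥0} {y J : ℝ → ℝ≥0} {ν : ℝ≥0}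
    (h : IsSaddlePoint p N R j y J ν) (hp : IsGainPDF p) (hN : 0 < N) {J' : Strategy}
    (hJ' : Admissible p j J') :
    securedOutage p N R Pbar J' ≤ 1 - onFraction p N R Pbar j := by
  have hm := h.measurable_uncurry_reply hJ'.1
  have htotal : ∫⁻ ω, framePower p (reply N y (J' ω)) ≤ requiredPower p N R j := by
    calc ∫⁻ ω, framePower p (reply N y (J' ω))
        ≤ ∫⁻ ω, (N.toNNReal * (∫⁻ h, (y h : ℝ≥0∞) ∂(gainMeasure p)) +
            ν * framePower p (J' ω)) := lintegral_mono fun ω => h.framePower_reply_le _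
      _ = N.toNNReal * (∫⁻ h, (y h : ℝ≥0∞) ∂(gainMeasure p)) +
            ν * ∫⁻ ω, framePower p (J' ω) := by
        rw [lintegral_add_left measurable_const, lintegral_const_mul' (ν : ℝ≥0∞) _ ENNReal.coe_ne_top]
        simp
      _ ≤ requiredPower p N R j := by
        rw [h.requiredPower_eq hN]
        gcongr
        exact hJ'.2
  obtain ⟨S, hS, hvol, hint⟩ := exists_volume_eq_setLIntegral_le
    (measurable_framePower_strategy hp hm) (onFraction_le_one p N R Pbar j)
  have hPm := measurable_uncurry_indicator hS hm
  have hP : Admissible p Pbar (S.indicator fun ω => reply N y (J' ω)) := by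
    refine ⟨hPm, ?_⟩
    rw [framePower_indicator, lintegral_indicator hS]
    exact (hint.trans (mul_le_mul_right htotal _)).trans (onFraction_mul_le p N R Pbar j)
  refine (iInf₂_le _ hP).trans ?_
  rw [outage_eq hp hPm hJ'.1, ← hvol]
  refine tsub_le_tsub_left (measure_mono fun ω hω => ?_) _
  change ENNReal.ofReal R ≤ capacity p N (S.indicator _ ω) (J' ω)
  rw [Set.indicator_of_mem hω]
  exact (h.capacity_reply hN _).ge

/-- Against uniform jamming, the saddle point reply costs no more than `requiredPower` in a frame,
hence exactly that much. -/
theorem IsSaddlePoint.isOnOff {j : ℝ≥0} {y J : ℝ → ℝ≥0} {ν : ℝ≥0}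
    (h : IsSaddlePoint p N R j y J ν) (hN : 0 < N) {J' : Strategy}
    (hJ' : IsUniformJamming p N R j J') {S : Set unitInterval} (hS : MeasurableSet S) :
    IsOnOff p N R (requiredPower p N R j) S J' (S.indicator fun ω => reply N y (J' ω)) := by
  refine ⟨measurable_uncurry_indicator hS (h.measurable_uncurry_reply hJ'.1), fun ω hω => ?_,
    fun ω hω => Set.indicator_of_notMem hω _⟩
  rw [Set.indicator_of_mem hω]
  have hcap := (h.capacity_reply hN (J' ω)).ge
  refine ⟨le_antisymm ?_ ?_, hcap⟩
  · rw [h.requiredPower_eq hN, ← (hJ'.2 ω).1]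
    exact h.framePower_reply_le _
  · rw [← (hJ'.2 ω).2]
    exact minPower_le _ _ (h.measurable_reply hJ'.1.of_uncurry_left) hcap

theorem IsOnOff.admissible {Pbar j : ℝ≥0} {S : Set unitInterval} {J P : Strategy}
    (hP : IsOnOff p N R (requiredPower p N R j) S J P) (hS : MeasurableSet S)
    (hvol : volume S = onFraction p N R Pbar j) : Admissible p Pbar P := by
  refine ⟨hP.1, ?_⟩
  have : (fun ω => framePower p (P ω)) = S.indicator fun _ => requiredPower p N R j := by
    ext ω
    by_cases hω : ω ∈ S
    · rw [Set.indicator_of_mem hω, (hP.2.1 ω hω).1]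
    · rw [Set.indicator_of_notMem hω, hP.2.2 ω hω, framePower_zero]
  rw [this, lintegral_indicator_const hS, hvol, mul_comm]
  exact onFraction_mul_le p N R Pbar j

theorem IsOnOff.outage_le {a : ℝ≥0∞} {S : Set unitInterval} {J P : Strategy}
    (hP : IsOnOff p N R a S J P) (hp : IsGainPDF p) (hJ : Measurable (Function.uncurry J)) :
    outage p N R P J ≤ 1 - volume S := by
  rw [outage_eq hp hP.1 hJ]
  exact tsub_le_tsub_left (measure_mono fun ω hω => (hP.2.1 ω hω).2) _

theorem framePower_pos_of_rate_le_capacity {P J : ℝ → ℝ≥0} (hR : 0 < R) (hP : Measurable P)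
    (hcap : ENNReal.ofReal R ≤ capacity p N P J) : 0 < framePower p P := by
  rw [pos_iff_ne_zero]
  intro h0
  rw [framePower, lintegral_eq_zero_iff hP.coe_nnreal_ennreal] at h0
  have : capacity p N P J = 0 := by
    rw [capacity, ← lintegral_zero (μ := gainMeasure p)]
    refine lintegral_congr_ae ?_
    filter_upwards [h0] with h hh
    have : P h = 0 := by simpa using hh
    simp [this]
  rw [this, nonpos_iff_eq_zero, ENNReal.ofReal_eq_zero] at hcap
  linarith

/-- If a reply reaches the rate on the maximal fraction of frames, then no power is left for the
other frames. -/
theorem IsUniformJamming.volume_framePower_pos {Pbar j : ℝ≥0} {J P : Strategy}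
    (hJ : IsUniformJamming p N R j J) (hp : IsGainPDF p) (hR : 0 < R)
    (hpos : 0 < requiredPower p N R j) (htop : requiredPower p N R j < ⊤)
    (hP : Admissible p Pbar P)
    (hvol : volume {ω | ENNReal.ofReal R ≤ capacity p N (P ω) (J ω)} = onFraction p N R Pbar j) :
    volume {ω | 0 < framePower p (P ω)} = onFraction p N R Pbar j := by
  set S := {ω | ENNReal.ofReal R ≤ capacity p N (P ω) (J ω)} with hSdef
  have hS : MeasurableSet S := measurableSet_rate_le_capacity hp hP.1 hJ.1
  have hle : volume S ≤ volume {ω | 0 < framePower p (P ω)} := measure_mono fun ω hω =>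
    framePower_pos_of_rate_le_capacity hR hP.1.of_uncurry_left hω
  rcases (onFraction_le_one p N R Pbar j).eq_or_lt with h1 | h1
  · exact le_antisymm (h1 ▸ prob_le_one) (hvol ▸ hle)
  · have h2 : onFraction p N R Pbar j = Pbar / requiredPower p N R j :=
      min_eq_right ((min_lt_iff.1 h1).resolve_left (lt_irrefl _)).le
    have h3 : (Pbar : ℝ≥0∞) ≤ ∫⁻ ω in S, framePower p (P ω) := by
      calc (Pbar : ℝ≥0∞) = requiredPower p N R j * volume S := by
            rw [hvol, h2, ENNReal.mul_div_cancel hpos.ne' htop.ne]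
        _ = ∫⁻ _ in S, requiredPower p N R j := (setLIntegral_const _ _).symm
        _ ≤ ∫⁻ ω in S, framePower p (P ω) := by
            refine setLIntegral_mono' hS fun ω hω => ?_
            rw [← (hJ.2 ω).2]
            exact minPower_le _ _ hP.1.of_uncurry_left hω
    have h4 : ∫⁻ ω in Sᶜ, framePower p (P ω) = 0 := by
      have h5 := hP.2
      rw [← lintegral_add_compl _ hS] at h5
      have h6 := (add_le_add_left h3 _).trans h5
      nth_rewrite 2 [← add_zero (Pbar : ℝ≥0∞)] at h6
      exact nonpos_iff_eq_zero.1 ((ENNReal.add_le_add_iff_left ENNReal.coe_ne_top).1 h6)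
    rw [lintegral_eq_zero_iff (measurable_framePower_strategy hp hP.1), Filter.EventuallyEq,
      ae_restrict_iff' hS.compl] at h4
    refine le_antisymm ?_ (hvol ▸ hle)
    rw [← hvol]
    refine measure_mono_ae ?_
    filter_upwards [h4] with ω h5 h6
    by_contra h7
    exact (show 0 < framePower p (P ω) from h6).ne' (h5 h7)

end Jamming

theorem mainTheorem8 (p : ℝ → ℝ) (hp : Jamming.IsGainPDF p)
    (hlog : Integrable (fun h => Real.log (1 + h)) (Jamming.gainMeasure p))
    (N R : ℝ) (hN : 0 < N) (hR : 0 < R) (Pbar Jbar : ℝ≥0) :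
    -- the required power is positive and finite, and it is attained within a frame
    (0 < Jamming.requiredPower p N R Jbar ∧ Jamming.requiredPower p N R Jbar < ⊤) ∧
    (∃ P J : ℝ → ℝ≥0, Measurable P ∧ Measurable J ∧
      Jamming.framePower p J = Jbar ∧
      Jamming.minPower p N R J = Jamming.requiredPower p N R Jbar ∧
      ENNReal.ofReal R ≤ Jamming.capacity p N P J ∧
      Jamming.framePower p P = Jamming.requiredPower p N R Jbar) ∧
    -- investing the same power in all frames is feasible and optimal for the jammer
    (∃ J, Jamming.IsUniformJamming p N R Jbar J) ∧
    ∀ J, Jamming.IsUniformJamming p N R Jbar J →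
      Jamming.IsMaximinOptimal p N R Pbar Jbar J ∧
      Jamming.securedOutage p N R Pbar J = 1 - Jamming.onFraction p N R Pbar Jbar ∧
      -- any set of frames of the right size can be chosen by the transmitter
      (∀ S, MeasurableSet S → volume S = Jamming.onFraction p N R Pbar Jbar →
        (∃ P, Jamming.IsOnOff p N R (Jamming.requiredPower p N R Jbar) S J P) ∧
        ∀ P, Jamming.IsOnOff p N R (Jamming.requiredPower p N R Jbar) S J P →
          Jamming.IsBestResponse p N R Pbar J P) ∧
      -- such sets exist, and every optimal reply is active on that fraction of the frames
      (∃ S : Set unitInterval, MeasurableSet S ∧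
        volume S = Jamming.onFraction p N R Pbar Jbar) ∧
      ∀ P, Jamming.IsBestResponse p N R Pbar J P →
        Jamming.outage p N R P J = 1 - Jamming.onFraction p N R Pbar Jbar ∧
        volume {ω | 0 < Jamming.framePower p (P ω)} = Jamming.onFraction p N R Pbar Jbar := by
  obtain ⟨y, Js, ν, hs⟩ := Jamming.exists_isSaddlePoint hp hlog hN hR Jbar
  have hpos := hs.requiredPower_pos hN hR
  have htop := hs.requiredPower_lt_top hp hN
  have hone := Jamming.onFraction_le_one p N R Pbar Jbar
  refine ⟨⟨hpos, htop⟩, ⟨Jamming.reply N y Js, Js, hs.measurable_reply hs.measurable_jam,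
    hs.measurable_jam, hs.framePower_jam, (hs.requiredPower_eq_minPower hN).symm,
    (hs.capacity_reply hN Js).ge, ?_⟩, ⟨fun _ => Js, hs.measurable_jam.comp measurable_snd,
    fun _ => ⟨hs.framePower_jam, (hs.requiredPower_eq_minPower hN).symm⟩⟩, fun J hJ => ?_⟩
  · rw [hs.requiredPower_eq_minPower hN, hs.minPower_jam]
  have hsec : Jamming.securedOutage p N R Pbar J = 1 - Jamming.onFraction p N R Pbar Jbar :=
    le_antisymm (hs.securedOutage_le hp hN hJ.admissible)
      (le_iInf₂ fun P hP => hJ.one_sub_onFraction_le_outage hp hpos htop hP)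
  obtain ⟨S₀, hS₀, hvol₀, -⟩ := Jamming.exists_volume_eq_setLIntegral_le
    (f := fun _ => 0) measurable_const hone
  refine ⟨⟨hJ.admissible, fun J' hJ' => ?_⟩, hsec, fun S hS hvol => ⟨⟨_, hs.isOnOff hN hJ hS⟩,
    fun P hP => ⟨hP.admissible hS hvol, fun P' hP' => ?_⟩⟩, ⟨S₀, hS₀, hvol₀⟩, fun P hP => ?_⟩
  · rw [hsec]
    exact hs.securedOutage_le hp hN hJ'
  · refine (hP.outage_le hp hJ.1).trans ?_
    rw [hvol]
    exact hJ.one_sub_onFraction_le_outage hp hpos htop hP'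
  · have hout : Jamming.outage p N R P J = 1 - Jamming.onFraction p N R Pbar Jbar := by
      have hon := hs.isOnOff hN hJ hS₀
      refine le_antisymm ?_ (hJ.one_sub_onFraction_le_outage hp hpos htop hP.1)
      rw [← hvol₀]
      exact (hP.2 _ (hon.admissible hS₀ hvol₀)).trans (hon.outage_le hp hJ.1)
    refine ⟨hout, hJ.volume_framePower_pos hp hR hpos htop hP.1 ?_⟩
    rw [Jamming.outage_eq hp hP.1.1 hJ.1] at hout
    rw [← ENNReal.sub_sub_cancel ENNReal.one_ne_top hone, ← hout,
      ENNReal.sub_sub_cancel ENNReal.one_ne_top prob_le_one]
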